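/- For $k\ge 0$ call a permutation $\pi$ of $[n]=\{1,\dots,n\}$ (in one-line notation) $k$-convex if $\pi(i-1)+\pi(i+1)-2\pi(i)\le k$ for all $1<i<n$. Let $f_1(n)$ be the number of $1$-convex permutations of length $n$ and $F_1(q)=\sum_{n\ge 0} f_1(n)q^n$. The left and right descendants of $\pi$ are $L(\pi)=1(\pi(1)+1)\cdots(\pi(n)+1)$ and $R(\pi)=(\pi(1)+1)\cdots(\pi(n)+1)1$. Two $1$-convex permutations are identically-descending if, for every $i\ge 0$, the same number of words $W\in\{L,R\}^i$ give a $1$-convex permutation when applied to either of them. Let $G$ be the digraph whose vertices are the classes of identically-descending $1$-convex permutations, with an edge from the class of $\pi$ to the class of each of $L(\pi)$, $R(\pi)$ that is $1$-convex. For $l\ge1$ let $v_l$ be the class of $12\cdots(l+2)$, so that $v_1$ is the class of $123$ and $v_{l+1}$ is the class of the left descendant of $12\cdots(l+2)$. For $m\ge 1$ let $T_m$ be the subgraph of $G$ induced by the vertices $v_l$ with $l\ge m$ together with the classes of $L^j(R(12\cdots(l+2)))$ for $l\ge m+1$, $0\le j<l$ (the interior vertices of the path $R L^{l}$ of $l+1$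 edges from $v_l$ to $v_{l-1}$), and put $T=T_1$. Let $H_m(q)$ be the generating function, by length, of the walks in $T_m$ from $v_m$ to $v_m$; let $\mathrm{bot}(q)=H_1(q)$ be that of the walks in $T$ from $v_1$ to $v_1$, and $\mathrm{tot}(q)$ that of all walks in $T$ starting at $v_1$. Then, as formal power series in $q$, $$H_m(q)=\cfrac{1}{1-\cfrac{q^{m+3}}{1-\cfrac{q^{m+4}}{1-\cfrac{q^{m+5}}{\ddots}}}}\quad(m\ge 1),\qquad \mathrm{bot}(q)=\cfrac{1}{1-\cfrac{q^{4}}{1-\cfrac{q^{5}}{1-\cfrac{q^{6}}{\ddots}}}},$$ $$\mathrm{tot}(q)=H_1(q)+\sum_{n\ge 1}q^n\,(1+q+\cdots+q^{n+1})\prod_{i=1}^{n+1}H_i(q),$$ $$F_1(q)=1+q-2q^2\,\frac{1+\mathrm{bot}(q)\,q^2+\mathrm{tot}(q)\,q}{-1+q+\mathrm{bot}(q)\,q^3}.$$ -/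

import Mathlib

open scoped PowerSeries

namespace LocallyConvex

/-- A word is `k`-convex if `w(i-1) + w(i+1) - 2 w(i) ≤ k` at every interior position. -/
def IsConvexWord (k : ℕ) (w : List ℕ) : Prop :=
  ∀ (i : ℕ) (_ : i + 2 < w.length),
    (w[i] : ℤ) + (w[i + 2] : ℤ) - 2 * (w[i + 1] : ℤ) ≤ (k : ℤ)

/-- One-line notation `π(1) π(2) … π(n)`, with entries in `{1, …, n}`. -/
def oneLine {n : ℕ} (π : Equiv.Perm (Fin n)) : List ℕ :=
  List.ofFn fun i => (π i : ℕ) + 1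

/-- The number `f_k(n)` of `k`-convex permutations of length `n`. -/
noncomputable def numConvex (k n : ℕ) : ℕ :=
  Nat.card {π : Equiv.Perm (Fin n) // IsConvexWord k (oneLine π)}

/-- The generating function `F_k(q) = ∑_{n ≥ 0} f_k(n) q^n`. -/
noncomputable def genFun (k : ℕ) : ℚ⟦X⟧ :=
  PowerSeries.mk fun n => (numConvex k n : ℚ)

/-- The left descendant `1 (π(1)+1) … (π(n)+1)`. -/
def leftDesc (w : List ℕ) : List ℕ := 1 :: w.map (· + 1)

/-- The right descendant `(π(1)+1) … (π(n)+1) 1`. -/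
def rightDesc (w : List ℕ) : List ℕ := w.map (· + 1) ++ [1]

/-- The two letters of the alphabet `{L, R}`. -/
inductive Side where
  | L
  | R

/-- The descendant of `w` on the given side. -/
def desc (w : List ℕ) : Side → List ℕ
  | Side.L => leftDesc w
  | Side.R => rightDesc w

/-- `W(π) = W_n(… (W_2(W_1(π))) …)` for a word `W = W_1 W_2 … W_n` on `{L, R}`. -/
def applyWord (W : List Side) (w : List ℕ) : List ℕ := W.foldl desc w

/-- `d_k(π, i)`: the number of words `W` on `{L, R}` of length `i` such that `W(π)` is
`k`-convex. -/
noncomputable def numDesc (k : ℕ) (w : List ℕ) (i : ℕ) : ℕ :=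
  Nat.card {W : List Side // W.length = i ∧ IsConvexWord k (applyWord W w)}

/-- The `k`-convex permutations of all lengths, in one-line notation. -/
def ConvexPerm (k : ℕ) : Type :=
  {w : List ℕ // (∃ (n : ℕ) (π : Equiv.Perm (Fin n)), oneLine π = w) ∧ IsConvexWord k w}

/-- `π` and `τ` are identically-descending if `d_k(π, i) = d_k(τ, i)` for all `i`. -/
noncomputable def identDesc (k : ℕ) : Setoid (ConvexPerm k) := Setoid.ker fun π => numDesc k π.1

/-- The vertices of the transition digraph: classes of identically-descending `k`-convex
permutations. -/
def Vertex (k : ℕ) : Type := Quotient (identDesc k)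

/-- `x` is the class of the `k`-convex permutation with one-line notation `w`. -/
def IsClassOf (k : ℕ) (w : List ℕ) (x : Vertex k) : Prop :=
  ∃ π : ConvexPerm k, π.1 = w ∧ Quotient.mk (identDesc k) π = x

/-- The identically-descending transition digraph: an edge leads from the class of `π` to the
class of each `k`-convex left or right descendant of `π`. -/
def transitionDigraph (k : ℕ) : Digraph (Vertex k) where
  Adj x y := ∃ (w : List ℕ) (s : Side), IsClassOf k w x ∧ IsClassOf k (desc w s) y

/-- The permutation `1 2 3 … (l+2)`, abbreviated `12(l+1)(l+2)`; for `l ≥ 1` it is the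
`(l-1)`-fold left descendant of `123`. -/
def node (l : ℕ) : List ℕ := List.range' 1 (l + 2)

/-- The vertices of the graph `T_m`: the classes `12(l+1)(l+2)` for `l ≥ m`, and, for each
`l ≥ m + 1`, the interior vertices `L^j(R(12(l+1)(l+2)))`, `j < l`, of the path of `l + 1` edges
(one right descent, then `l` left descents) leading from `12(l+1)(l+2)` to `12(l)(l+1)`. -/
def towerVerts (m : ℕ) : Set (Vertex 1) :=
  {x | ∃ l : ℕ, m ≤ l ∧ IsClassOf 1 (node l) x} ∪
  {x | ∃ l j : ℕ, m + 1 ≤ l ∧ j < l ∧ IsClassOf 1 (leftDesc^[j] (rightDesc (node l))) x}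

/-- The walks with `n` edges in the subgraph of the transition digraph induced by `S`, as the
sequences of their `n + 1` vertices. -/
def IsWalkIn (S : Set (Vertex 1)) (n : ℕ) (p : Fin (n + 1) → Vertex 1) : Prop :=
  (∀ i, p i ∈ S) ∧ ∀ i : Fin n, (transitionDigraph 1).Adj (p i.castSucc) (p i.succ)

/-- `H_m(q)`: the generating function by length of the walks in `T_m` from `12(m+1)(m+2)` to
itself. -/
noncomputable def H (m : ℕ) : ℚ⟦X⟧ :=
  PowerSeries.mk fun n =>
    (Nat.card {p : Fin (n + 1) → Vertex 1 //
      IsWalkIn (towerVerts m) n p ∧ IsClassOf 1 (node m) (p 0) ∧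
        IsClassOf 1 (node m) (p (Fin.last n))} : ℚ)

/-- `bot(q)`: the generating function by length of the walks in `T = T_1` from `123` to `123`. -/
noncomputable def bot : ℚ⟦X⟧ := H 1

/-- `tot(q)`: the generating function by length of all walks in `T = T_1` starting at `123`. -/
noncomputable def tot : ℚ⟦X⟧ :=
  PowerSeries.mk fun n =>
    (Nat.card {p : Fin (n + 1) → Vertex 1 //
      IsWalkIn (towerVerts 1) n p ∧ IsClassOf 1 (node 1) (p 0)} : ℚ)

/-- Convergence of a sequence of formal power series: every coefficient is eventually equal to
the corresponding coefficient of the limit. -/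
def FormalTendsto (s : ℕ → ℚ⟦X⟧) (F : ℚ⟦X⟧) : Prop :=
  ∀ n : ℕ, ∀ᶠ N in Filter.atTop, PowerSeries.coeff n (s N) = PowerSeries.coeff n F

/-- The `N`-th convergent of the continued fraction
`1 / (1 - q^(m+3) / (1 - q^(m+4) / (1 - q^(m+5) / ⋯)))`. -/
noncomputable def convergent : ℕ → ℕ → ℚ⟦X⟧
  | 0, _ => 1
  | N + 1, m => (1 - PowerSeries.X ^ (m + 3) * convergent N (m + 1))⁻¹

/-- The terms `H_1`, `q H_1 H_2 (1+q+q²)`, `q² H_1 H_2 H_3 (1+q+q²+q³)`, … of the series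
for `tot(q)`. -/
noncomputable def totTerm (n : ℕ) : ℚ⟦X⟧ :=
  PowerSeries.X ^ n * (∏ i ∈ Finset.Icc 1 (n + 1), H i) *
    (if n = 0 then 1 else ∑ j ∈ Finset.range (n + 2), PowerSeries.X ^ j)

end LocallyConvex

/-!
The letter `1` of a `1`-convex permutation is at one of its ends, so every nonempty `1`-convex
permutation arises from `[1]` by a unique sequence of descents (`numConvex_succ`), and `F_1` counts
words on `{L, R}` all of whose prefixes give `1`-convex permutations.

Whether a descent is `1`-convex depends on the two letters at that end alone, and up to reversal
only a pair `(l, r)`, `r ≤ l + 1`, matters (`HasState`): `(l, 0)` is the state of `1 2 … (l+2)`,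
and `(l, r)` with `r > 0` has to make `r` descents on a fixed side, which lead to `(l, 0)`. Thus
`(l, r + 1)` has the only successor `(l, r)`, while `(l, 0)` has the successors `(l + 1, 0)` and
`(l - 1, l)`, where `(0, 0)` returns to itself. All `1`-convex permutations of length at least
`2` have a state (`IsPermWord.exists_hasState`), and distinct states have distinct sequences of
descendant counts (`eq_of_stateCount_eq`). Hence the vertices of `T_m`, `m ≥ 1`, are the states with
`l ≥ m`, the edges are the transitions just listed, and the walks in `T_m` are counted by a
recursion over states (`ncard_walksIn`).

For the generating functions `Y l` of walks from `(l, 0)` the recursion becomes a linear system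
`Y l = c l + q Y (l+1) + q^(l+1) Y (l-1)`, cut off at `l = m`. Its solution is unique, since the
unknowns on the right carry positive powers of `q` (`Solves.unique`). So the decompositions of walks
at their visits to level `m` hold as soon as both sides solve the same system
(`returnSeries_succ`, `totalSeries_succ`, `descSeries_of_one_le`). They give
`H_m (1 - q^(m+3) H_(m+1)) = 1`, which iterates to the continued fraction, a similar recurrence for
the total counts, which iterates to the series for `tot`, and two linear equations for the walks
from `12` and from `123`, which give `F_1`.
-/

namespace LocallyConvex

/-! ### Convex words and their descendants -/

theorem isConvexWord_of_length_le_two (k : ℕ) {w : List ℕ} (h : w.length ≤ 2) :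
    IsConvexWord k w := fun i hi => by omega

theorem isConvexWord_cons_cons_cons (k a b c : ℕ) (u : List ℕ) :
    IsConvexWord k (a :: b :: c :: u) ↔ a + c ≤ 2 * b + k ∧ IsConvexWord k (b :: c :: u) := by
  constructor
  · intro h
    refine ⟨?_, fun i hi => ?_⟩
    · have := h 0 (by simp)
      simp at this
      omega
    · exact h (i + 1) (by simpa using hi)
  · rintro ⟨h1, h2⟩ i hi
    cases i with
    | zero => simp; omega
    | succ i => exact h2 i (by simpa using hi)

theorem isConvexWord_map_add_one (k : ℕ) (w : List ℕ) :
    IsConvexWord k (w.map (· + 1)) ↔ IsConvexWord k w := by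
  unfold IsConvexWord
  simp only [List.length_map, List.getElem_map]
  refine forall₂_congr fun i hi => ?_
  push_cast
  constructor <;> intro h <;> linarith

theorem IsConvexWord.reverse {k : ℕ} {w : List ℕ} (h : IsConvexWord k w) :
    IsConvexWord k w.reverse := by
  intro i hi
  simp only [List.length_reverse] at hi
  have := h (w.length - 1 - (i + 2)) (by omega)
  simp only [List.getElem_reverse]
  have e1 : w.length - 1 - (i + 2) + 2 = w.length - 1 - i := by omega
  have e2 : w.length - 1 - (i + 2) + 1 = w.length - 1 - (i + 1) := by omega
  simp only [e1, e2] at this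
  linarith

theorem isConvexWord_reverse (k : ℕ) (w : List ℕ) :
    IsConvexWord k w.reverse ↔ IsConvexWord k w :=
  ⟨fun h => by simpa using h.reverse, fun h => h.reverse⟩

theorem reverse_leftDesc (w : List ℕ) : (leftDesc w).reverse = rightDesc w.reverse := by
  simp [leftDesc, rightDesc]

theorem reverse_rightDesc (w : List ℕ) : (rightDesc w).reverse = leftDesc w.reverse := by
  simp [leftDesc, rightDesc]

theorem IsConvexWord.of_leftDesc {k : ℕ} {w : List ℕ} (h : IsConvexWord k (leftDesc w)) :
    IsConvexWord k w := by
  rw [← isConvexWord_map_add_one]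
  intro i hi
  exact h (i + 1) (by simp [leftDesc] at hi ⊢; omega)

theorem IsConvexWord.of_rightDesc {k : ℕ} {w : List ℕ} (h : IsConvexWord k (rightDesc w)) :
    IsConvexWord k w := by
  have := h.reverse
  rw [reverse_rightDesc] at this
  exact (isConvexWord_reverse k w).1 this.of_leftDesc

theorem IsConvexWord.of_desc {k : ℕ} {w : List ℕ} {s : Side} (h : IsConvexWord k (desc w s)) :
    IsConvexWord k w := by
  cases s
  · exact IsConvexWord.of_leftDesc h
  · exact IsConvexWord.of_rightDesc h

/-- The first two letters of `w` are `a`, `b` and the last two are `c`, `d`. -/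
def Ends (w : List ℕ) (a b c d : ℕ) : Prop :=
  (∃ u, w = a :: b :: u) ∧ ∃ u, w.reverse = d :: c :: u

theorem Ends.reverse {w : List ℕ} {a b c d : ℕ} (h : Ends w a b c d) :
    Ends w.reverse d c b a :=
  ⟨h.2, by simpa using h.1⟩

theorem Ends.leftDesc {w : List ℕ} {a b c d : ℕ} (h : Ends w a b c d) :
    Ends (leftDesc w) 1 (a + 1) (c + 1) (d + 1) := by
  obtain ⟨⟨u, hu⟩, v, hv⟩ := h
  refine ⟨⟨(b :: u).map (· + 1), by simp [LocallyConvex.leftDesc, hu]⟩, v.map (· + 1) ++ [1], ?_⟩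
  rw [reverse_leftDesc, hv]
  simp [LocallyConvex.rightDesc]

theorem Ends.rightDesc {w : List ℕ} {a b c d : ℕ} (h : Ends w a b c d) :
    Ends (rightDesc w) (a + 1) (b + 1) (d + 1) 1 := by
  simpa [reverse_leftDesc] using h.reverse.leftDesc.reverse

theorem Ends.isConvexWord_leftDesc_iff {k : ℕ} {w : List ℕ} {a b c d : ℕ} (h : Ends w a b c d) :
    IsConvexWord k (LocallyConvex.leftDesc w) ↔ IsConvexWord k w ∧ b ≤ 2 * a + k := by
  obtain ⟨⟨u, rfl⟩, -⟩ := h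
  rw [← isConvexWord_map_add_one k (a :: b :: u), LocallyConvex.leftDesc, List.map_cons,
    List.map_cons, isConvexWord_cons_cons_cons, and_comm]
  refine and_congr_right fun _ => ?_
  omega

theorem Ends.isConvexWord_rightDesc_iff {k : ℕ} {w : List ℕ} {a b c d : ℕ}
    (h : Ends w a b c d) :
    IsConvexWord k (LocallyConvex.rightDesc w) ↔ IsConvexWord k w ∧ c ≤ 2 * d + k := by
  rw [← isConvexWord_reverse, reverse_rightDesc, h.reverse.isConvexWord_leftDesc_iff,
    isConvexWord_reverse]

/-! ### Permutation words -/

/-- `w` is the one-line notation of a permutation of `{1, …, |w|}`. -/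
def IsPermWord (w : List ℕ) : Prop := w.Perm (List.range' 1 w.length)

theorem isPermWord_iff (w : List ℕ) :
    IsPermWord w ↔ ∃ (n : ℕ) (π : Equiv.Perm (Fin n)), oneLine π = w := by
  constructor
  · intro h
    have hnd : w.Nodup := h.nodup_iff.2 List.nodup_range'
    have hmem : ∀ i : Fin w.length, 1 ≤ w[i] ∧ w[i] < 1 + w.length := fun i => by
      simpa using h.mem_iff.1 (List.getElem_mem i.2)
    let f : Fin w.length → Fin w.length := fun i =>
      ⟨w[i] - 1, by have := hmem i; omega⟩
    have hf : Function.Injective f := by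
      intro i j hij
      have h1 := hmem i
      have h2 := hmem j
      have h3 : w[i] - 1 = w[j] - 1 := congrArg Fin.val hij
      have h4 : w[(i : ℕ)] = w[(j : ℕ)] := by
        simp only [Fin.getElem_fin] at *
        omega
      exact Fin.ext ((hnd.getElem_inj_iff).1 h4)
    refine ⟨w.length, Equiv.ofBijective f (Finite.injective_iff_bijective.1 hf), ?_⟩
    refine List.ext_getElem (by simp [oneLine]) fun i h1 h2 => ?_
    have := hmem ⟨i, h2⟩
    simp only [Fin.getElem_fin] at this
    simp only [oneLine, List.getElem_ofFn, Equiv.ofBijective_apply, f, Fin.getElem_fin]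
    omega
  · rintro ⟨n, π, rfl⟩
    have hl : (oneLine π).length = n := by simp [oneLine]
    rw [IsPermWord, hl, List.perm_ext_iff_of_nodup _ List.nodup_range']
    · intro a
      simp only [oneLine, List.mem_ofFn, List.mem_range'_1]
      constructor
      · rintro ⟨i, rfl⟩
        have := (π i).2
        omega
      · rintro ⟨h1, h2⟩
        refine ⟨π.symm ⟨a - 1, by omega⟩, ?_⟩
        simp only [Equiv.apply_symm_apply]
        omega
    · rw [oneLine, List.nodup_ofFn]
      intro i j hij
      simpa [Fin.val_inj] using hij

theorem oneLine_injective (n : ℕ) :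
    Function.Injective (oneLine : Equiv.Perm (Fin n) → List ℕ) := by
  intro π τ h
  ext i
  have := congrFun (List.ofFn_injective h) i
  simpa using this

theorem IsPermWord.reverse {w : List ℕ} (h : IsPermWord w) : IsPermWord w.reverse := by
  unfold IsPermWord at *
  rw [List.length_reverse]
  exact (List.reverse_perm w).trans h

theorem isPermWord_leftDesc (w : List ℕ) : IsPermWord (leftDesc w) ↔ IsPermWord w := by
  have e : List.range' 1 (leftDesc w).length = 1 :: (List.range' 1 w.length).map (· + 1) := by
    have h := List.map_add_range' (a := 1) 1 w.length 1
    simp only [add_comm 1] at h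
    simp only [leftDesc, List.length_cons, List.length_map, List.range'_succ, h]
  rw [IsPermWord, e, leftDesc, List.perm_cons]
  constructor
  · intro h
    have := h.map (· - 1)
    rw [IsPermWord]
    simpa [Function.comp_def] using this
  · intro h
    exact h.map _

theorem isPermWord_reverse (w : List ℕ) : IsPermWord w.reverse ↔ IsPermWord w :=
  ⟨fun h => by simpa using h.reverse, fun h => h.reverse⟩

theorem isPermWord_desc (w : List ℕ) (s : Side) : IsPermWord (desc w s) ↔ IsPermWord w := by
  cases s
  · exact isPermWord_leftDesc w
  · change IsPermWord (rightDesc w) ↔ _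
    rw [← isPermWord_reverse, reverse_rightDesc, isPermWord_leftDesc, isPermWord_reverse]

theorem IsPermWord.one_le {w : List ℕ} (h : IsPermWord w) {x : ℕ} (hx : x ∈ w) : 1 ≤ x := by
  have := h.mem_iff.1 hx
  simp at this
  omega

theorem exists_eq_leftDesc {t : List ℕ} (h : IsPermWord (1 :: t)) : ∃ w, 1 :: t = leftDesc w := by
  have hnd : (1 :: t).Nodup := h.nodup_iff.2 List.nodup_range'
  refine ⟨t.map (· - 1), ?_⟩
  rw [leftDesc, List.map_map]
  congr 1
  conv_lhs => rw [← List.map_id t]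
  refine List.map_congr_left fun x hx => ?_
  have := h.one_le (List.mem_cons_of_mem 1 hx)
  simp only [id_eq, Function.comp_apply]
  omega

/-- In a nonempty `1`-convex permutation the letter `1` is at one of the ends: between two larger
neighbours the second difference would be at least `2`. -/
theorem IsPermWord.exists_eq_desc {w : List ℕ} (h : IsPermWord w) (hc : IsConvexWord 1 w)
    (hw : w ≠ []) : ∃ w' s, w = desc w' s := by
  have hnd : w.Nodup := h.nodup_iff.2 List.nodup_range'
  have hpos : 0 < w.length := List.length_pos_iff.2 hw
  have h1 : 1 ∈ w := h.mem_iff.2 (by simp; omega)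
  obtain ⟨i, hi, hiw⟩ := List.getElem_of_mem h1
  have key : i = 0 ∨ i + 1 = w.length := by
    by_contra! hcon
    obtain ⟨j, rfl⟩ : ∃ j, i = j + 1 := ⟨i - 1, by omega⟩
    have hconv := hc j (by omega)
    have hne : ∀ m (hm : m < w.length), m ≠ j + 1 → 2 ≤ w[m] := by
      intro m hm hmj
      have a1 := h.one_le (List.getElem_mem hm)
      have a2 : w[m] ≠ 1 := fun e => hmj ((hnd.getElem_inj_iff).1 (e.trans hiw.symm))
      omega
    have b1 := hne j (by omega) (by omega)
    have b2 := hne (j + 2) (by omega) (by omega)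
    rw [hiw] at hconv
    omega
  rcases key with rfl | hlast
  · obtain ⟨x, t, rfl⟩ := List.exists_cons_of_ne_nil hw
    simp only [List.getElem_cons_zero] at hiw
    subst hiw
    obtain ⟨w', hw'⟩ := exists_eq_leftDesc h
    exact ⟨w', Side.L, hw'⟩
  · obtain ⟨x, t, ht⟩ := List.exists_cons_of_ne_nil (l := w.reverse) (by simpa using hw)
    have hx : x = 1 := by
      have h0 : w.reverse[0]'(by simpa using hpos) = x := by simp [ht]
      rw [List.getElem_reverse] at h0
      have : w.length - 1 - 0 = i := by omega
      simp only [this] at h0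
      omega
    subst hx
    obtain ⟨w', hw'⟩ := exists_eq_leftDesc (t := t) (ht ▸ h.reverse)
    refine ⟨w'.reverse, Side.R, ?_⟩
    rw [← List.reverse_reverse w, ht, hw', reverse_leftDesc]
    rfl

/-! ### Counting descendants -/

theorem length_desc (w : List ℕ) (s : Side) : (desc w s).length = w.length + 1 := by
  cases s <;> simp [desc, leftDesc, rightDesc]

theorem isConvexWord_of_applyWord {k : ℕ} {w : List ℕ} (W : List Side)
    (h : IsConvexWord k (applyWord W w)) : IsConvexWord k w := by
  induction W generalizing w with
  | nil => exact h
  | cons s W ih => exact (ih (w := desc w s) h).of_desc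

instance : Finite Side := by
  refine Finite.of_injective (fun s : Side => match s with | .L => true | .R => false) ?_
  intro a b h
  cases a <;> cases b <;> simp_all

theorem finite_words (i : ℕ) (p : List Side → Prop) :
    {W : List Side | W.length = i ∧ p W}.Finite :=
  (List.finite_length_eq Side i).subset fun _ h => h.1

theorem numDesc_eq_ncard (k : ℕ) (w : List ℕ) (i : ℕ) :
    numDesc k w i = {W : List Side | W.length = i ∧ IsConvexWord k (applyWord W w)}.ncard := rfl

theorem numDesc_zero {k : ℕ} {w : List ℕ} (h : IsConvexWord k w) : numDesc k w 0 = 1 := by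
  rw [numDesc_eq_ncard, Set.ncard_eq_one]
  refine ⟨[], ?_⟩
  ext W
  simp only [List.length_eq_zero_iff, Set.mem_ofPred_eq, Set.mem_singleton_iff]
  exact ⟨fun h => h.1, fun hW => ⟨hW, hW ▸ h⟩⟩

theorem numDesc_succ (k : ℕ) (w : List ℕ) (i : ℕ) :
    numDesc k w (i + 1) = numDesc k (leftDesc w) i + numDesc k (rightDesc w) i := by
  simp only [numDesc_eq_ncard]
  rw [← Set.ncard_image_of_injective {W : List Side | _ ∧ IsConvexWord k (applyWord W (leftDesc w))}
      (List.cons_injective (a := Side.L)),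
    ← Set.ncard_image_of_injective {W : List Side | _ ∧ IsConvexWord k (applyWord W (rightDesc w))}
      (List.cons_injective (a := Side.R)),
    ← Set.ncard_union_eq _ ((finite_words _ _).image _) ((finite_words _ _).image _)]
  · congr 1
    ext W
    constructor
    · rintro ⟨h1, h2⟩
      match W, h1, h2 with
      | .L :: W, h1, h2 => exact Or.inl ⟨W, ⟨by simpa using h1, h2⟩, rfl⟩
      | .R :: W, h1, h2 => exact Or.inr ⟨W, ⟨by simpa using h1, h2⟩, rfl⟩
    · rintro (⟨W, ⟨h1, h2⟩, rfl⟩ | ⟨W, ⟨h1, h2⟩, rfl⟩) <;> exact ⟨by simpa using h1, h2⟩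
  · rw [Set.disjoint_left]
    rintro _ ⟨W, -, rfl⟩ ⟨W', -, h⟩
    cases h

theorem numDesc_eq_zero {k : ℕ} {w : List ℕ} (h : ¬ IsConvexWord k w) (i : ℕ) :
    numDesc k w i = 0 := by
  rw [numDesc_eq_ncard]
  convert Set.ncard_empty (List Side)
  ext W
  simp only [Set.mem_ofPred_eq, Set.mem_empty_iff_false, iff_false, not_and]
  exact fun _ hW => h (isConvexWord_of_applyWord W hW)

/-! ### States of `1`-convex permutations -/

/-- The word `w` is `1`-convex and in state `(l, r)`: its first `r` descents have to be left ones,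
and lead to a word with the same possible descents as `1 2 … (l+2)`. Only the first two letters
`a`, `b` and the last two letters `c`, `d` matter. The bound `b ≤ 2 a + 1` admits a left descent. A
right descent requires `c ≤ 2 d + 1`, which fails by exactly `r` if `r > 0`; every left descent
lowers the excess by one and raises `d`, so that `d = l + 2` once a right descent is admitted. -/
def HasStateL (l r : ℕ) (w : List ℕ) : Prop :=
  IsConvexWord 1 w ∧ ∃ a b c d, Ends w a b c d ∧ 1 ≤ a ∧ a ≤ 2 ∧ b ≤ 2 * a + 1 ∧ 1 ≤ d ∧
    d + r = l + 2 ∧ c ≤ 2 * d + 1 + r ∧ (r ≠ 0 → c = 2 * d + 1 + r) ∧ (r = 0 → a = 1)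

/-- The word `w` or its reversal is in state `(l, r)`, see `HasStateL`. -/
def HasState (l r : ℕ) (w : List ℕ) : Prop := HasStateL l r w ∨ HasStateL l r w.reverse

theorem HasState.isConvexWord {l r : ℕ} {w : List ℕ} (h : HasState l r w) :
    IsConvexWord 1 w := h.elim (·.1) fun h => (isConvexWord_reverse 1 w).1 h.1

theorem HasState.reverse {l r : ℕ} {w : List ℕ} (h : HasState l r w) : HasState l r w.reverse :=
  h.symm.imp id fun h => by simpa using h

theorem hasState_reverse {l r : ℕ} {w : List ℕ} : HasState l r w.reverse ↔ HasState l r w :=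
  ⟨fun h => by simpa using h.reverse, fun h => h.reverse⟩

theorem HasStateL.leftDesc_succ {l r : ℕ} {w : List ℕ} (h : HasStateL l (r + 1) w) :
    HasStateL l r (leftDesc w) := by
  obtain ⟨hc, a, b, c, d, he, h⟩ := h
  exact ⟨he.isConvexWord_leftDesc_iff.2 ⟨hc, by omega⟩, _, _, _, _, he.leftDesc, by omega⟩

theorem HasStateL.not_rightDesc_succ {l r : ℕ} {w : List ℕ} (h : HasStateL l (r + 1) w) :
    ¬ IsConvexWord 1 (rightDesc w) := by
  obtain ⟨hc, a, b, c, d, he, h⟩ := h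
  rw [he.isConvexWord_rightDesc_iff]
  omega

theorem HasStateL.leftDesc_zero {l : ℕ} {w : List ℕ} (h : HasStateL l 0 w) :
    HasStateL (l + 1) 0 (leftDesc w) := by
  obtain ⟨hc, a, b, c, d, he, h⟩ := h
  exact ⟨he.isConvexWord_leftDesc_iff.2 ⟨hc, by omega⟩, _, _, _, _, he.leftDesc, by omega⟩

theorem HasStateL.rightDesc_add_one {l : ℕ} {w : List ℕ} (h : HasStateL (l + 1) 0 w) :
    HasStateL l (l + 1) (rightDesc w) := by
  obtain ⟨hc, a, b, c, d, he, h⟩ := h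
  exact ⟨he.isConvexWord_rightDesc_iff.2 ⟨hc, by omega⟩, _, _, _, _, he.rightDesc, by omega⟩

/-- For `l = 0` the right descendant is, up to reversal, in state `(0, 0)` again. -/
theorem HasStateL.rightDesc_zero {l : ℕ} {w : List ℕ} (h : HasStateL l 0 w) :
    HasState (l - 1) l (rightDesc w) := by
  cases l with
  | zero =>
    obtain ⟨hc, a, b, c, d, he, h⟩ := h
    have hconv : IsConvexWord 1 (rightDesc w) := he.isConvexWord_rightDesc_iff.2 ⟨hc, by omega⟩
    exact Or.inr ⟨hconv.reverse, _, _, _, _, he.rightDesc.reverse, by omega⟩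
  | succ l => exact Or.inl h.rightDesc_add_one

theorem HasState.desc_zero {l : ℕ} {w : List ℕ} (h : HasState l 0 w) :
    (HasState (l + 1) 0 (leftDesc w) ∧ HasState (l - 1) l (rightDesc w)) ∨
      (HasState (l - 1) l (leftDesc w) ∧ HasState (l + 1) 0 (rightDesc w)) := by
  rcases h with h | h
  · exact Or.inl ⟨Or.inl h.leftDesc_zero, h.rightDesc_zero⟩
  · refine Or.inr ⟨?_, ?_⟩
    · rw [← hasState_reverse, reverse_leftDesc]
      exact h.rightDesc_zero
    · rw [← hasState_reverse, reverse_rightDesc]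
      exact Or.inl h.leftDesc_zero

theorem HasState.desc_succ {l r : ℕ} {w : List ℕ} (h : HasState l (r + 1) w) :
    (HasState l r (leftDesc w) ∧ ¬ IsConvexWord 1 (rightDesc w)) ∨
      (¬ IsConvexWord 1 (leftDesc w) ∧ HasState l r (rightDesc w)) := by
  rcases h with h | h
  · exact Or.inl ⟨Or.inl h.leftDesc_succ, h.not_rightDesc_succ⟩
  · refine Or.inr ⟨?_, ?_⟩
    · rw [← isConvexWord_reverse, reverse_leftDesc]
      exact h.not_rightDesc_succ
    · rw [← hasState_reverse, reverse_rightDesc]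
      exact Or.inl h.leftDesc_succ

theorem hasStateL_one_two : HasStateL 0 0 [1, 2] :=
  ⟨isConvexWord_of_length_le_two 1 (by simp), 1, 2, 1, 2, ⟨⟨[], rfl⟩, ⟨[], rfl⟩⟩, by omega⟩

theorem hasState_desc_one (s : Side) : HasState 0 0 (desc [1] s) := by
  cases s
  · exact Or.inl hasStateL_one_two
  · exact Or.inr hasStateL_one_two

theorem HasState.exists_desc {l r : ℕ} {w : List ℕ} {s : Side} (h : HasState l r w)
    (hs : IsConvexWord 1 (desc w s)) : ∃ l' r', HasState l' r' (desc w s) := by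
  cases r with
  | zero => rcases h.desc_zero with h | h <;> cases s <;> [exact ⟨_, _, h.1⟩; exact ⟨_, _, h.2⟩;
      exact ⟨_, _, h.1⟩; exact ⟨_, _, h.2⟩]
  | succ r => rcases h.desc_succ with h | h <;> cases s <;> [exact ⟨_, _, h.1⟩; exact (h.2 hs).elim;
      exact (h.1 hs).elim; exact ⟨_, _, h.2⟩]

theorem isPermWord_nil : IsPermWord [] := List.Perm.refl _

/-- Every `1`-convex permutation of length at least `2` has a state. -/
theorem IsPermWord.exists_hasState {w : List ℕ} (h : IsPermWord w) (hc : IsConvexWord 1 w) :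
    w = [] ∨ w = [1] ∨ ∃ l r, HasState l r w := by
  induction hn : w.length generalizing w with
  | zero => exact Or.inl (List.length_eq_zero_iff.1 hn)
  | succ n ih =>
    obtain ⟨w', s, rfl⟩ := h.exists_eq_desc hc (by rintro rfl; simp at hn)
    rw [isPermWord_desc] at h
    rw [length_desc] at hn
    rcases ih h hc.of_desc (by omega) with rfl | rfl | ⟨l, r, hlr⟩
    · exact Or.inr (Or.inl (by cases s <;> rfl))
    · exact Or.inr (Or.inr ⟨0, 0, hasState_desc_one s⟩)
    · exact Or.inr (Or.inr (hlr.exists_desc hc))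

/-! ### Counting walks on the states -/

open Classical in
/-- The weighted number of walks of length `n` from the state `(l, r)`, where `(l, r + 1)` leads to
`(l, r)` and `(l, 0)` leads to `(l + 1, 0)` and, if `g l` holds, to `(l - 1, l)`. A walk that ends in
the state `(l, r)` has weight `e l r`. -/
noncomputable def walkCount (e : ℕ → ℕ → ℕ) (g : ℕ → Prop) : ℕ → ℕ → ℕ → ℕ
  | 0, l, r => e l r
  | n + 1, l, 0 => walkCount e g n (l + 1) 0 + if g l then walkCount e g n (l - 1) l else 0
  | n + 1, l, r + 1 => walkCount e g n l r

/-- The number of all walks of length `n` from the state `(l, r)`. -/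
noncomputable def stateCount (n l r : ℕ) : ℕ := walkCount (fun _ _ => 1) (fun _ => True) n l r

theorem stateCount_zero (l r : ℕ) : stateCount 0 l r = 1 := by simp [stateCount, walkCount]

theorem stateCount_succ_zero (n l : ℕ) :
    stateCount (n + 1) l 0 = stateCount n (l + 1) 0 + stateCount n (l - 1) l := by
  simp [stateCount, walkCount]

theorem stateCount_succ_succ (n l r : ℕ) : stateCount (n + 1) l (r + 1) = stateCount n l r := by
  simp [stateCount, walkCount]

theorem HasState.numDesc_eq {l r : ℕ} {w : List ℕ} (h : HasState l r w) (n : ℕ) :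
    numDesc 1 w n = stateCount n l r := by
  induction n generalizing l r w with
  | zero => rw [numDesc_zero h.isConvexWord, stateCount_zero]
  | succ n ih =>
    rw [numDesc_succ]
    cases r with
    | zero =>
      rw [stateCount_succ_zero]
      rcases h.desc_zero with ⟨h1, h2⟩ | ⟨h1, h2⟩
      · rw [ih h1, ih h2]
      · rw [ih h1, ih h2, add_comm]
    | succ r =>
      rw [stateCount_succ_succ]
      rcases h.desc_succ with ⟨h1, h2⟩ | ⟨h1, h2⟩
      · rw [ih h1, numDesc_eq_zero h2, add_zero]
      · rw [ih h2, numDesc_eq_zero h1, zero_add]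

theorem stateCount_of_le {n r : ℕ} (h : n ≤ r) (l : ℕ) : stateCount n l r = 1 := by
  induction n generalizing r with
  | zero => exact stateCount_zero l r
  | succ n ih =>
    obtain ⟨r, rfl⟩ : ∃ r', r = r' + 1 := ⟨r - 1, by omega⟩
    rw [stateCount_succ_succ, ih (by omega)]

theorem stateCount_add (n l r : ℕ) : stateCount (n + r) l r = stateCount n l 0 := by
  induction r with
  | zero => rfl
  | succ r ih => rw [← add_assoc, stateCount_succ_succ, ih]

theorem stateCount_one_zero (l : ℕ) : stateCount 1 l 0 = 2 := by
  rw [stateCount_succ_zero, stateCount_zero, stateCount_zero]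

theorem stateCount_of_le_add_one {n l : ℕ} (h : n ≤ l + 1) : stateCount n l 0 = n + 1 := by
  induction n generalizing l with
  | zero => exact stateCount_zero l 0
  | succ n ih => rw [stateCount_succ_zero, ih (by omega), stateCount_of_le (by omega)]

theorem stateCount_add_two (l : ℕ) : stateCount (l + 2) l 0 = l + 4 := by
  rw [stateCount_succ_zero, stateCount_of_le_add_one (by omega), add_comm l 1, stateCount_add,
    stateCount_one_zero]
  omega

/-- The sequence of descendant counts determines the state: `r` is read off from the number of
initial ones, and then the counts of `(l, 0)` and `(l', 0)`, `l < l'`, first differ at `l + 2`. -/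
theorem eq_of_stateCount_eq {l r l' r' : ℕ} (h : ∀ n, stateCount n l r = stateCount n l' r') :
    l = l' ∧ r = r' := by
  have hr : ∀ {l r l' r' : ℕ}, (∀ n, stateCount n l r = stateCount n l' r') → ¬ r < r' := by
    intro l r l' r' h hlt
    have := h (1 + r)
    rw [stateCount_add, stateCount_one_zero, stateCount_of_le (by omega)] at this
    omega
  have hl : ∀ {l l' : ℕ}, (∀ n, stateCount n l 0 = stateCount n l' 0) → ¬ l < l' := by
    intro l l' h hlt
    have := h (l + 2)
    rw [stateCount_add_two, stateCount_of_le_add_one (by omega)] at this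
    omega
  obtain rfl : r = r' := le_antisymm (not_lt.1 (hr fun n => (h n).symm)) (not_lt.1 (hr h))
  have h' : ∀ n, stateCount n l 0 = stateCount n l' 0 := fun n => by
    rw [← stateCount_add, h, stateCount_add]
  exact ⟨le_antisymm (not_lt.1 (hl fun n => (h' n).symm)) (not_lt.1 (hl h')), rfl⟩

theorem HasState.unique {l r l' r' : ℕ} {w : List ℕ} (h : HasState l r w)
    (h' : HasState l' r' w) : l = l' ∧ r = r' :=
  eq_of_stateCount_eq fun n => by rw [← h.numDesc_eq, ← h'.numDesc_eq]

theorem numDesc_one_succ (n : ℕ) : numDesc 1 [1] (n + 1) = 2 * stateCount n 0 0 := by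
  have hL : numDesc 1 (leftDesc [1]) n = _ := (hasState_desc_one Side.L).numDesc_eq n
  have hR : numDesc 1 (rightDesc [1]) n = _ := (hasState_desc_one Side.R).numDesc_eq n
  rw [numDesc_succ, hL, hR, two_mul]

theorem numDesc_one_zero : numDesc 1 [1] 0 = 1 :=
  numDesc_zero (isConvexWord_of_length_le_two 1 (by simp))

theorem numDesc_nil_succ (n : ℕ) : numDesc 1 [] (n + 1) = 2 * numDesc 1 [1] n := by
  rw [numDesc_succ, two_mul]
  rfl

/-- A `1`-convex permutation with the descendant counts of a state `(l, r)`, `l ≥ 1`, is in that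
state. -/
theorem hasState_of_numDesc_eq {l r : ℕ} (hl : 1 ≤ l) {w : List ℕ}
    (hp : IsPermWord w) (hc : IsConvexWord 1 w) (h : ∀ n, numDesc 1 w n = stateCount n l r) :
    HasState l r w := by
  -- The empty word and `[1]` have four descendants of order `2`; a state with `l ≥ 1` has fewer.
  have key : ¬ (numDesc 1 w 1 = 2 ∧ numDesc 1 w 2 = 4) := by
    rw [h, h]
    cases r with
    | zero => rw [stateCount_of_le_add_one (by omega : 2 ≤ l + 1)]; omega
    | succ r => rw [stateCount_of_le (by omega)]; omega
  rcases hp.exists_hasState hc with rfl | rfl | ⟨l', r', h'⟩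
  · refine absurd ⟨?_, ?_⟩ key
    · rw [numDesc_nil_succ, numDesc_one_zero]
    · rw [numDesc_nil_succ, numDesc_one_succ, stateCount_zero]
  · refine absurd ⟨?_, ?_⟩ key
    · rw [numDesc_one_succ, stateCount_zero]
    · rw [numDesc_one_succ, stateCount_one_zero]
  · obtain ⟨rfl, rfl⟩ : l' = l ∧ r' = r :=
      eq_of_stateCount_eq fun n => by rw [← h, h'.numDesc_eq]
    exact h'

/-! ### The vertices and edges of the towers -/

/-- A `1`-convex permutation in the state `(l, r)`, `r ≤ l + 1`. For larger `r` the value is that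
for `r = l + 1`. -/
def stateWord (l : ℕ) : ℕ → List ℕ
  | 0 => node l
  | r + 1 => leftDesc^[l - r] (rightDesc (node (l + 1)))

theorem leftDesc_node (l : ℕ) : leftDesc (node l) = node (l + 1) := by
  have h := List.map_add_range' (a := 1) 1 (l + 2) 1
  simp only [add_comm 1] at h
  rw [leftDesc, node, h, node, show l + 1 + 2 = (l + 2) + 1 from rfl,
    List.range'_succ (n := l + 2)]

theorem hasStateL_node (l : ℕ) : HasStateL l 0 (node l) := by
  induction l with
  | zero => exact hasStateL_one_two
  | succ l ih => exact leftDesc_node l ▸ ih.leftDesc_zero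

theorem isPermWord_node (l : ℕ) : IsPermWord (node l) := by
  simp [IsPermWord, node]

theorem hasStateL_iterate_leftDesc {l j : ℕ} (hj : j ≤ l + 1) :
    HasStateL l (l + 1 - j) (leftDesc^[j] (rightDesc (node (l + 1)))) := by
  induction j with
  | zero => exact (hasStateL_node (l + 1)).rightDesc_add_one
  | succ j ih =>
    rw [Function.iterate_succ_apply']
    have h := ih (by omega)
    rw [show l + 1 - j = l + 1 - (j + 1) + 1 by omega] at h
    exact h.leftDesc_succ

theorem hasState_stateWord_min (l r : ℕ) : HasState l (min r (l + 1)) (stateWord l r) := by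
  cases r with
  | zero => exact Or.inl (by simpa [stateWord] using hasStateL_node l)
  | succ r =>
    have h := hasStateL_iterate_leftDesc (l := l) (j := l - r) (by omega)
    rw [show l + 1 - (l - r) = min (r + 1) (l + 1) by omega] at h
    exact Or.inl h

theorem hasState_stateWord {l r : ℕ} (h : r ≤ l + 1) : HasState l r (stateWord l r) := by
  simpa [h] using hasState_stateWord_min l r

theorem isPermWord_iterate_leftDesc (j : ℕ) (w : List ℕ) :
    IsPermWord (leftDesc^[j] w) ↔ IsPermWord w := by
  induction j with
  | zero => rfl
  | succ j ih => rw [Function.iterate_succ_apply', isPermWord_leftDesc, ih]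

theorem isPermWord_stateWord (l r : ℕ) : IsPermWord (stateWord l r) := by
  cases r with
  | zero => exact isPermWord_node l
  | succ r =>
    rw [stateWord, isPermWord_iterate_leftDesc]
    exact (isPermWord_desc _ Side.R).2 (isPermWord_node _)

/-- The class of the `1`-convex permutations in the state `(l, r)`, `r ≤ l + 1`. -/
noncomputable def stateVertex (l r : ℕ) : Vertex 1 :=
  Quotient.mk (identDesc 1) ⟨stateWord l r, (isPermWord_iff _).1 (isPermWord_stateWord l r),
    (hasState_stateWord_min l r).isConvexWord⟩

theorem isClassOf_stateWord {l r : ℕ} {x : Vertex 1} :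
    IsClassOf 1 (stateWord l r) x ↔ x = stateVertex l r := by
  constructor
  · rintro ⟨⟨w, hw⟩, rfl, rfl⟩
    rfl
  · rintro rfl
    exact ⟨_, rfl, rfl⟩

theorem isClassOf_stateVertex {l r : ℕ} (hl : 1 ≤ l) (hr : r ≤ l + 1) {w : List ℕ} :
    IsClassOf 1 w (stateVertex l r) ↔ IsPermWord w ∧ HasState l r w := by
  constructor
  · rintro ⟨⟨w, hp, hc⟩, rfl, h⟩
    have h' : numDesc 1 w = numDesc 1 (stateWord l r) := Quotient.exact h
    rw [← isPermWord_iff] at hp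
    exact ⟨hp, hasState_of_numDesc_eq hl hp hc fun n => by
      rw [h', (hasState_stateWord hr).numDesc_eq]⟩
  · rintro ⟨hp, hs⟩
    refine ⟨⟨w, (isPermWord_iff w).1 hp, hs.isConvexWord⟩, rfl, Quotient.sound ?_⟩
    change numDesc 1 w = numDesc 1 (stateWord l r)
    funext n
    rw [hs.numDesc_eq, (hasState_stateWord hr).numDesc_eq]

theorem stateVertex_inj {l r l' r' : ℕ} (hl : 1 ≤ l) (hr : r ≤ l + 1) (hr' : r' ≤ l' + 1) :
    stateVertex l r = stateVertex l' r' ↔ l = l' ∧ r = r' := by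
  constructor
  · intro h
    have h' : IsClassOf 1 (stateWord l' r') (stateVertex l r) := h ▸ isClassOf_stateWord.2 rfl
    exact ((isClassOf_stateVertex hl hr).1 h').2.unique (hasState_stateWord hr')
  · rintro ⟨rfl, rfl⟩
    rfl

theorem mem_towerVerts {m : ℕ} {x : Vertex 1} :
    x ∈ towerVerts m ↔ ∃ l r, m ≤ l ∧ r ≤ l + 1 ∧ x = stateVertex l r := by
  constructor
  · rintro (⟨l, hl, h⟩ | ⟨l, j, hl, hj, h⟩)
    · exact ⟨l, 0, hl, by omega, (isClassOf_stateWord (r := 0)).1 h⟩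
    · obtain ⟨l, rfl⟩ : ∃ l', l = l' + 1 := ⟨l - 1, by omega⟩
      refine ⟨l, l - j + 1, by omega, by omega, isClassOf_stateWord.1 ?_⟩
      rwa [stateWord, show l - (l - j) = j by omega]
  · rintro ⟨l, r, hl, hr, rfl⟩
    have h : IsClassOf 1 (stateWord l r) (stateVertex l r) := isClassOf_stateWord.2 rfl
    cases r with
    | zero => exact Or.inl ⟨l, hl, h⟩
    | succ r => exact Or.inr ⟨l + 1, l - r, by omega, by omega, h⟩

theorem adj_stateVertex_zero {l l' r' : ℕ} (hl : 1 ≤ l) (hl' : 1 ≤ l') (hr' : r' ≤ l' + 1) :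
    (transitionDigraph 1).Adj (stateVertex l 0) (stateVertex l' r') ↔
      (l' = l + 1 ∧ r' = 0) ∨ (l' = l - 1 ∧ r' = l) := by
  constructor
  · rintro ⟨w, s, hw, hd⟩
    rw [isClassOf_stateVertex hl (by omega)] at hw
    rw [isClassOf_stateVertex hl' hr'] at hd
    rcases hw.2.desc_zero with h | h <;> cases s
    · exact Or.inl (hd.2.unique h.1)
    · exact Or.inr (hd.2.unique h.2)
    · exact Or.inr (hd.2.unique h.1)
    · exact Or.inl (hd.2.unique h.2)
  · intro h
    have hp : ∀ s, IsPermWord (desc (node l) s) := fun s =>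
      (isPermWord_desc _ s).2 (isPermWord_node l)
    have hw : IsClassOf 1 (node l) (stateVertex l 0) :=
      (isClassOf_stateWord (r := 0)).2 rfl
    rcases h with ⟨rfl, rfl⟩ | ⟨rfl, rfl⟩
    · exact ⟨node l, Side.L, hw, (isClassOf_stateVertex hl' hr').2
        ⟨hp _, Or.inl (hasStateL_node l).leftDesc_zero⟩⟩
    · exact ⟨node _, Side.R, hw, (isClassOf_stateVertex hl' hr').2
        ⟨hp _, (hasStateL_node _).rightDesc_zero⟩⟩

theorem adj_stateVertex_succ {l r l' r' : ℕ} (hl : 1 ≤ l) (hr : r + 1 ≤ l + 1) (hl' : 1 ≤ l')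
    (hr' : r' ≤ l' + 1) :
    (transitionDigraph 1).Adj (stateVertex l (r + 1)) (stateVertex l' r') ↔ l' = l ∧ r' = r := by
  constructor
  · rintro ⟨w, s, hw, hd⟩
    rw [isClassOf_stateVertex hl hr] at hw
    rw [isClassOf_stateVertex hl' hr'] at hd
    rcases hw.2.desc_succ with h | h <;> cases s
    · exact hd.2.unique h.1
    · exact (h.2 hd.2.isConvexWord).elim
    · exact (h.1 hd.2.isConvexWord).elim
    · exact hd.2.unique h.2
  · rintro ⟨rfl, rfl⟩
    have hp : ∀ s, IsPermWord (desc (stateWord l' (r' + 1)) s) := fun s =>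
      (isPermWord_desc _ s).2 (isPermWord_stateWord _ _)
    have hw : IsClassOf 1 (stateWord l' (r' + 1)) (stateVertex l' (r' + 1)) :=
      isClassOf_stateWord.2 rfl
    rcases (hasState_stateWord hr).desc_succ with h | h
    · exact ⟨_, Side.L, hw, (isClassOf_stateVertex hl' hr').2 ⟨hp _, h.1⟩⟩
    · exact ⟨_, Side.R, hw, (isClassOf_stateVertex hl' hr').2 ⟨hp _, h.2⟩⟩

/-! ### Counting walks in the towers -/

/-- The walks of length `n` in the subgraph induced by `S` that start at `x` and end in `E`. -/
def walksIn (S E : Set (Vertex 1)) (n : ℕ) (x : Vertex 1) : Set (Fin (n + 1) → Vertex 1) :=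
  {p | IsWalkIn S n p ∧ p 0 = x ∧ p (Fin.last n) ∈ E}

open Classical in
theorem walksIn_zero {S E : Set (Vertex 1)} {x : Vertex 1} (hx : x ∈ S) :
    walksIn S E 0 x = if x ∈ E then {fun _ => x} else ∅ := by
  ext p
  have hp : p = (fun _ => x) ↔ p 0 = x :=
    ⟨fun h => by rw [h], fun h => funext fun i => by
      obtain rfl : i = 0 := Fin.ext (by omega)
      exact h⟩
  have hlast : (Fin.last 0) = 0 := rfl
  constructor
  · rintro ⟨-, h0, h1⟩
    rw [hlast, h0] at h1
    simpa [h1, hp] using h0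
  · intro h
    split_ifs at h with hE
    · obtain rfl : p = _ := h
      exact ⟨⟨fun _ => hx, fun i => i.elim0⟩, rfl, hE⟩
    · exact h.elim

theorem walksIn_succ {S E : Set (Vertex 1)} {n : ℕ} {x : Vertex 1} (hx : x ∈ S) :
    walksIn S E (n + 1) x = ⋃ y ∈ {y | y ∈ S ∧ (transitionDigraph 1).Adj x y},
      Fin.cons (α := fun _ => Vertex 1) x '' walksIn S E n y := by
  ext p
  simp only [Set.mem_iUnion]
  constructor
  · rintro ⟨⟨h1, h2⟩, h3, h4⟩
    refine ⟨p 1, ⟨h1 1, h3 ▸ h2 0⟩, Fin.tail p, ⟨⟨fun i => h1 i.succ, fun i => ?_⟩, rfl, h4⟩, ?_⟩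
    · exact h2 i.succ
    · rw [← h3]
      exact Fin.cons_self_tail p
  · rintro ⟨y, ⟨hy, hxy⟩, p, ⟨⟨h1, h2⟩, h3, h4⟩, rfl⟩
    refine ⟨⟨fun i => ?_, fun i => ?_⟩, rfl, ?_⟩
    · refine Fin.cases hx (fun i => ?_) i
      simpa using h1 i
    · refine Fin.cases ?_ (fun i => ?_) i
      · simpa [h3] using hxy
      · exact h2 i
    · simpa [← Fin.succ_last] using h4

open Classical in
theorem ncard_walksIn {m : ℕ} (hm : 1 ≤ m) (E : Set (Vertex 1)) (n : ℕ) {l r : ℕ} (hl : m ≤ l)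
    (hr : r ≤ l + 1) :
    (walksIn (towerVerts m) E n (stateVertex l r)).Finite ∧
      (walksIn (towerVerts m) E n (stateVertex l r)).ncard =
        walkCount (fun l r => if stateVertex l r ∈ E then 1 else 0) (m < ·) n l r := by
  have hmem : ∀ {l r : ℕ}, m ≤ l → r ≤ l + 1 → stateVertex l r ∈ towerVerts m :=
    fun hl hr => mem_towerVerts.2 ⟨_, _, hl, hr, rfl⟩
  induction n generalizing l r with
  | zero =>
    rw [walksIn_zero (hmem hl hr), walkCount]
    split_ifs <;> simp
  | succ n ih =>
    have hinj : Function.Injective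
        (Fin.cons (n := n + 1) (α := fun _ => Vertex 1) (stateVertex l r)) :=
      Fin.cons_right_injective _
    rw [walksIn_succ (hmem hl hr)]
    cases r with
    | zero =>
      obtain ⟨fin1, card1⟩ := ih (l := l + 1) (r := 0) (by omega) (by omega)
      by_cases hlm : m < l
      · have hS : {y | y ∈ towerVerts m ∧ (transitionDigraph 1).Adj (stateVertex l 0) y} =
            {stateVertex (l + 1) 0, stateVertex (l - 1) l} := by
          ext y
          constructor
          · rintro ⟨hy, ha⟩
            obtain ⟨l', r', hl', hr', rfl⟩ := mem_towerVerts.1 hy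
            rcases (adj_stateVertex_zero (by omega) (by omega) hr').1 ha with
              ⟨rfl, rfl⟩ | ⟨rfl, rfl⟩
            · exact Or.inl rfl
            · exact Or.inr rfl
          · rintro (rfl | rfl)
            · exact ⟨hmem (by omega) (by omega),
                (adj_stateVertex_zero (by omega) (by omega) (by omega)).2 (Or.inl ⟨rfl, rfl⟩)⟩
            · exact ⟨hmem (by omega) (by omega),
                (adj_stateVertex_zero (by omega) (by omega) (by omega)).2 (Or.inr ⟨rfl, rfl⟩)⟩
        obtain ⟨fin2, card2⟩ := ih (l := l - 1) (r := l) (by omega) (by omega)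
        rw [hS, Set.biUnion_pair]
        refine ⟨(fin1.image _).union (fin2.image _), ?_⟩
        rw [Set.ncard_union_eq ?_ (fin1.image _) (fin2.image _),
          Set.ncard_image_of_injective _ hinj, Set.ncard_image_of_injective _ hinj, card1, card2,
          walkCount, if_pos hlm]
        rw [Set.disjoint_left]
        rintro _ ⟨p, hp, rfl⟩ ⟨p', hp', h⟩
        obtain rfl := hinj h
        have := hp.2.1.symm.trans hp'.2.1
        rw [stateVertex_inj (by omega) (by omega) (by omega)] at this
        omega
      · obtain rfl : m = l := by omega
        have hS : {y | y ∈ towerVerts m ∧ (transitionDigraph 1).Adj (stateVertex m 0) y} =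
            {stateVertex (m + 1) 0} := by
          ext y
          constructor
          · rintro ⟨hy, ha⟩
            obtain ⟨l', r', hl', hr', rfl⟩ := mem_towerVerts.1 hy
            rcases (adj_stateVertex_zero (by omega) (by omega) hr').1 ha with ⟨rfl, rfl⟩ | h
            · rfl
            · omega
          · rintro rfl
            exact ⟨hmem (by omega) (by omega),
              (adj_stateVertex_zero (by omega) (by omega) (by omega)).2 (Or.inl ⟨rfl, rfl⟩)⟩
        rw [hS, Set.biUnion_singleton]
        refine ⟨fin1.image _, ?_⟩
        rw [Set.ncard_image_of_injective _ hinj, card1, walkCount, if_neg hlm, add_zero]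
    | succ r =>
      obtain ⟨fin1, card1⟩ := ih (l := l) (r := r) (by omega) (by omega)
      have hS : {y | y ∈ towerVerts m ∧ (transitionDigraph 1).Adj (stateVertex l (r + 1)) y} =
          {stateVertex l r} := by
        ext y
        constructor
        · rintro ⟨hy, ha⟩
          obtain ⟨l', r', hl', hr', rfl⟩ := mem_towerVerts.1 hy
          obtain ⟨rfl, rfl⟩ := (adj_stateVertex_succ (by omega) hr (by omega) hr').1 ha
          rfl
        · rintro rfl
          exact ⟨hmem (by omega) (by omega),
            (adj_stateVertex_succ (by omega) hr (by omega) (by omega)).2 ⟨rfl, rfl⟩⟩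
      rw [hS, Set.biUnion_singleton]
      refine ⟨fin1.image _, ?_⟩
      rw [Set.ncard_image_of_injective _ hinj, card1, walkCount]

theorem walkCount_congr {e e' : ℕ → ℕ → ℕ} {g : ℕ → Prop} {m : ℕ} (hg : ∀ l, g l → m < l)
    (he : ∀ l r, m ≤ l → r ≤ l + 1 → e l r = e' l r) {n l r : ℕ} (hl : m ≤ l) (hr : r ≤ l + 1) :
    walkCount e g n l r = walkCount e' g n l r := by
  induction n generalizing l r with
  | zero => exact he l r hl hr
  | succ n ih =>
    cases r with
    | zero =>
      rw [walkCount, walkCount, ih (by omega) (by omega)]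
      split_ifs with h
      · have := hg l h
        rw [ih (by omega) (by omega)]
      · rfl
    | succ r => exact ih hl (by omega)

theorem coeff_H {m : ℕ} (hm : 1 ≤ m) (n : ℕ) :
    PowerSeries.coeff n (H m) =
      (walkCount (fun l r => if l = m ∧ r = 0 then 1 else 0) (fun l => m < l) n m 0 : ℚ) := by
  have h := (ncard_walksIn hm {stateVertex m 0} n (l := m) (r := 0) le_rfl (by omega)).2
  rw [walkCount_congr (m := m) (e' := fun l r => if l = m ∧ r = 0 then 1 else 0) (fun _ h => h)
    ?_ le_rfl (by omega)] at h
  · rw [H, PowerSeries.coeff_mk, ← h]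
    congr 1
    change Set.ncard _ = _
    congr 1
    ext p
    exact and_congr_right fun _ => and_congr (isClassOf_stateWord (r := 0))
      (isClassOf_stateWord (r := 0))
  · intro l r hl hr
    simp only [Set.mem_singleton_iff, stateVertex_inj (by omega : 1 ≤ l) hr (by omega : 0 ≤ m + 1)]

theorem coeff_tot (n : ℕ) :
    PowerSeries.coeff n tot = (walkCount (fun _ _ => 1) (1 < ·) n 1 0 : ℚ) := by
  rw [tot, PowerSeries.coeff_mk]
  congr 1
  have h := (ncard_walksIn le_rfl Set.univ n (l := 1) (r := 0) le_rfl (by omega)).2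
  simp only [Set.mem_univ, if_true] at h
  rw [← h]
  change Set.ncard _ = _
  congr 1
  ext p
  exact and_congr_right fun _ => ⟨fun h => ⟨(isClassOf_stateWord (r := 0)).1 h, trivial⟩,
    fun h => (isClassOf_stateWord (r := 0)).2 h.1⟩

/-! ### Counting `1`-convex permutations -/

theorem leftDesc_injective : Function.Injective leftDesc := fun _ _ h =>
  List.map_injective_iff.2 (add_left_injective 1) (List.cons_injective h)

theorem leftDesc_ne_rightDesc {w w' : List ℕ} (hw' : w' ≠ []) (h1 : ∀ x ∈ w', 1 ≤ x) :
    leftDesc w ≠ rightDesc w' := by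
  obtain ⟨x, t, rfl⟩ := List.exists_cons_of_ne_nil hw'
  intro h
  have h2 : 1 = x + 1 := (List.cons.inj h).1
  have := h1 x (by simp)
  omega

theorem desc_inj {w w' : List ℕ} {s s' : Side} (hw : IsPermWord w) (hw' : IsPermWord w')
    (hne : w ≠ []) (hne' : w' ≠ []) (h : desc w s = desc w' s') : w = w' ∧ s = s' := by
  cases s <;> cases s'
  · exact ⟨leftDesc_injective h, rfl⟩
  · exact (leftDesc_ne_rightDesc hne' (fun _ => hw'.one_le) h).elim
  · exact (leftDesc_ne_rightDesc hne (fun _ => hw.one_le) h.symm).elim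
  · refine ⟨List.reverse_injective (leftDesc_injective ?_), rfl⟩
    rw [← reverse_rightDesc, ← reverse_rightDesc]
    exact congrArg List.reverse h

theorem applyWord_concat (W : List Side) (s : Side) (w : List ℕ) :
    applyWord (W ++ [s]) w = desc (applyWord W w) s := by
  simp [applyWord]

theorem isPermWord_applyWord_one (W : List Side) : IsPermWord (applyWord W [1]) := by
  induction W using List.reverseRecOn with
  | nil => exact List.Perm.refl _
  | append_singleton W s ih => rwa [applyWord_concat, isPermWord_desc]

theorem length_applyWord (W : List Side) (w : List ℕ) :
    (applyWord W w).length = w.length + W.length := by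
  induction W using List.reverseRecOn with
  | nil => rfl
  | append_singleton W s ih => simp [applyWord_concat, length_desc, ih, add_assoc]

theorem applyWord_one_injective : Function.Injective fun W : List Side => applyWord W [1] := by
  have hne : ∀ W : List Side, applyWord W [1] ≠ [] := fun W h => by
    have := length_applyWord W [1]
    simp only [h, List.length_nil, List.length_singleton] at this
    omega
  intro W
  induction W using List.reverseRecOn with
  | nil =>
    intro W' h
    have := congrArg List.length h
    simp only [length_applyWord, List.length_nil] at this
    exact (List.length_eq_zero_iff.1 (by omega)).symm
  | append_singleton W s ih =>
    intro W' h
    rcases List.eq_nil_or_concat' W' with rfl | ⟨W', s', rfl⟩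
    · have := congrArg List.length h
      simp [length_applyWord] at this
    · simp only [applyWord_concat] at h
      obtain ⟨h1, rfl⟩ := desc_inj (isPermWord_applyWord_one W) (isPermWord_applyWord_one W')
        (hne W) (hne W') h
      rw [ih h1]

theorem IsPermWord.exists_eq_applyWord {w : List ℕ} (h : IsPermWord w) (hc : IsConvexWord 1 w)
    (hw : w ≠ []) : ∃ W, w = applyWord W [1] := by
  induction hn : w.length generalizing w with
  | zero => exact (hw (List.length_eq_zero_iff.1 hn)).elim
  | succ n ih =>
    obtain ⟨w', s, rfl⟩ := h.exists_eq_desc hc hw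
    rcases eq_or_ne w' [] with rfl | hw'
    · exact ⟨[], by cases s <;> rfl⟩
    · rw [length_desc] at hn
      obtain ⟨W, rfl⟩ := ih ((isPermWord_desc _ _).1 h) hc.of_desc hw' (by omega)
      exact ⟨W ++ [s], (applyWord_concat W s [1]).symm⟩

theorem numConvex_eq_ncard (k n : ℕ) :
    numConvex k n = {w : List ℕ | IsPermWord w ∧ w.length = n ∧ IsConvexWord k w}.ncard := by
  rw [numConvex]
  change Set.ncard {π : Equiv.Perm (Fin n) | IsConvexWord k (oneLine π)} = _
  rw [← Set.ncard_image_of_injective _ (oneLine_injective n)]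
  congr 1
  ext w
  constructor
  · rintro ⟨π, hπ, rfl⟩
    exact ⟨(isPermWord_iff _).2 ⟨n, π, rfl⟩, by simp [oneLine], hπ⟩
  · rintro ⟨hp, hl, hc⟩
    obtain ⟨n', π, rfl⟩ := (isPermWord_iff _).1 hp
    obtain rfl : n' = n := by simpa [oneLine] using hl
    exact ⟨π, hc, rfl⟩

theorem numConvex_zero (k : ℕ) : numConvex k 0 = 1 := by
  rw [numConvex_eq_ncard, Set.ncard_eq_one]
  refine ⟨[], ?_⟩
  ext w
  constructor
  · rintro ⟨-, h, -⟩
    exact List.length_eq_zero_iff.1 h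
  · rintro rfl
    exact ⟨isPermWord_nil, rfl, isConvexWord_of_length_le_two k (by simp)⟩

/-- Every nonempty `1`-convex permutation arises from `[1]` by exactly one sequence of descents. -/
theorem numConvex_succ (n : ℕ) : numConvex 1 (n + 1) = numDesc 1 [1] n := by
  rw [numConvex_eq_ncard, numDesc_eq_ncard,
    ← Set.ncard_image_of_injective _ applyWord_one_injective]
  congr 1
  ext w
  constructor
  · rintro ⟨hp, hl, hc⟩
    obtain ⟨W, rfl⟩ := hp.exists_eq_applyWord hc (by rintro rfl; simp at hl)
    rw [length_applyWord, List.length_singleton] at hl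
    exact ⟨W, ⟨by omega, hc⟩, rfl⟩
  · rintro ⟨W, ⟨hl, hc⟩, rfl⟩
    refine ⟨isPermWord_applyWord_one W, ?_, hc⟩
    simp only [length_applyWord, List.length_singleton]
    omega

theorem numConvex_add_two (n : ℕ) : numConvex 1 (n + 2) = 2 * stateCount n 0 0 := by
  rw [numConvex_succ, numDesc_one_succ]

theorem numConvex_one : numConvex 1 1 = 1 := by
  rw [numConvex_succ, numDesc_one_zero]

/-! ### Generating functions of the walks -/

open PowerSeries

theorem coeff_succ_natCast (c n : ℕ) : coeff (n + 1) (c : ℚ⟦X⟧) = 0 := by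
  rw [← map_natCast (C (R := ℚ)), coeff_C, if_neg (by omega)]

/-- The generating function by length of the weighted walks from the state `(l, 0)`. -/
noncomputable def walkSeries (e : ℕ → ℕ → ℕ) (g : ℕ → Prop) (l : ℕ) : ℚ⟦X⟧ :=
  PowerSeries.mk fun n => (walkCount e g n l 0 : ℚ)

/-- The sum `q + q² + ⋯ + q^m`. -/
noncomputable def stairSum (m : ℕ) : ℚ⟦X⟧ := ∑ j ∈ Finset.range m, X ^ (j + 1)

theorem mk_walkCount_of_const {e : ℕ → ℕ → ℕ} {g : ℕ → Prop} {c : ℕ}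
    (hc : ∀ l r, e l (r + 1) = c) (l r : ℕ) :
    X * PowerSeries.mk (fun n => (walkCount e g n l r : ℚ)) =
      (c : ℚ⟦X⟧) * stairSum r + X ^ (r + 1) * walkSeries e g l := by
  induction r with
  | zero => simp [stairSum, walkSeries]
  | succ r ih =>
    have h : PowerSeries.mk (fun n => (walkCount e g n l (r + 1) : ℚ)) =
        (c : ℚ⟦X⟧) + X * PowerSeries.mk (fun n => (walkCount e g n l r : ℚ)) := by
      ext n
      cases n with
      | zero => simp [walkCount, hc]
      | succ n => simp [walkCount, coeff_succ_X_mul, coeff_succ_natCast]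
    have hs : stairSum (r + 1) = X + X * stairSum r := by
      rw [stairSum, Finset.sum_range_succ', stairSum, Finset.mul_sum, add_comm]
      simp [pow_succ']
    rw [h, ih, hs]
    ring

open Classical in
theorem walkSeries_eq {e : ℕ → ℕ → ℕ} {g : ℕ → Prop} {c : ℕ} (hc : ∀ l r, e l (r + 1) = c)
    (l : ℕ) :
    walkSeries e g l = (e l 0 : ℚ⟦X⟧) + X * walkSeries e g (l + 1) +
      if g l then (c : ℚ⟦X⟧) * stairSum l + X ^ (l + 1) * walkSeries e g (l - 1) else 0 := by
  rw [← mk_walkCount_of_const hc]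
  ext n
  cases n with
  | zero => split_ifs <;> simp [walkSeries, walkCount]
  | succ n => split_ifs with h <;> simp [walkSeries, walkCount, coeff_succ_X_mul,
      coeff_succ_natCast, h]

/-- The tridiagonal linear system satisfied by the generating functions of the walks in `T_m`. -/
def Solves (m : ℕ) (c Y : ℕ → ℚ⟦X⟧) : Prop :=
  Y m = c m + X * Y (m + 1) ∧
    ∀ l, m < l → Y l = c l + X * Y (l + 1) + X ^ (l + 1) * Y (l - 1)

/-- Every unknown on the right of the system carries a positive power of `X`, so its solution is
determined coefficient by coefficient. -/
theorem Solves.unique {m : ℕ} {c Y Z : ℕ → ℚ⟦X⟧} (hY : Solves m c Y) (hZ : Solves m c Z) {l : ℕ}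
    (hl : m ≤ l) : Y l = Z l := by
  ext n
  induction n using Nat.strong_induction_on generalizing l with
  | _ n ih =>
    have h1 : coeff n (X * Y (l + 1)) = coeff n (X * Z (l + 1)) := by
      cases n with
      | zero => simp
      | succ n => rw [coeff_succ_X_mul, coeff_succ_X_mul, ih n (by omega) (by omega)]
    rcases hl.eq_or_lt with rfl | hlt
    · rw [hY.1, hZ.1, map_add, map_add, h1]
    · have h2 : coeff n (X ^ (l + 1) * Y (l - 1)) = coeff n (X ^ (l + 1) * Z (l - 1)) := by
        rw [coeff_X_pow_mul', coeff_X_pow_mul']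
        split_ifs with h
        · exact ih _ (by omega) (by omega)
        · rfl
      rw [hY.2 l hlt, hZ.2 l hlt]
      simp only [map_add, h1, h2]

theorem Solves.add_mul {m : ℕ} {c c' Y Z : ℕ → ℚ⟦X⟧} (hY : Solves m c Y) (hZ : Solves m c' Z)
    (a : ℚ⟦X⟧) : Solves m (fun l => c l + c' l * a) (fun l => Y l + Z l * a) := by
  refine ⟨?_, fun l hl => ?_⟩
  · dsimp only
    rw [hY.1, hZ.1]
    ring
  · dsimp only
    rw [hY.2 l hl, hZ.2 l hl]
    ring

/-- The generating function of the walks in `T_m` from `12(l+1)(l+2)` to `12(m+1)(m+2)`. -/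
noncomputable def returnSeries (m l : ℕ) : ℚ⟦X⟧ :=
  walkSeries (fun l r => if l = m ∧ r = 0 then 1 else 0) (fun l => m < l) l

/-- The generating function of all walks in `T_m` from `12(l+1)(l+2)`. -/
noncomputable def totalSeries (m l : ℕ) : ℚ⟦X⟧ :=
  walkSeries (fun _ _ => 1) (fun l => m < l) l

/-- The generating function of all walks from `12(l+1)(l+2)`, that is, of the numbers of its
`1`-convex descendants. -/
noncomputable def descSeries (l : ℕ) : ℚ⟦X⟧ :=
  walkSeries (fun _ _ => 1) (fun _ => True) l

theorem H_eq {m : ℕ} (hm : 1 ≤ m) : H m = returnSeries m m := by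
  ext n
  rw [coeff_H hm, returnSeries, walkSeries, coeff_mk]

theorem tot_eq : tot = totalSeries 1 1 := by
  ext n
  rw [coeff_tot, totalSeries, walkSeries, coeff_mk]

theorem solves_returnSeries (m : ℕ) :
    Solves m (fun l => if l = m then 1 else 0) (returnSeries m) := by
  have h := fun l => walkSeries_eq (e := fun l r => if l = m ∧ r = 0 then 1 else 0)
    (g := fun l => m < l) (c := 0) (fun l r => by simp) l
  refine ⟨?_, fun l hl => ?_⟩
  · simpa [returnSeries] using h m
  · simpa [returnSeries, hl, hl.ne'] using h l

/-- The generating function of the walks that start at `12(l+1)(l+2)` and stop there or on the path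
to `12(l)(l+1)`, if that path is in `T_m`. -/
noncomputable def totalSource (m l : ℕ) : ℚ⟦X⟧ := if m < l then 1 + stairSum l else 1

theorem solves_totalSeries (m : ℕ) : Solves m (totalSource m) (totalSeries m) := by
  have h := fun l => walkSeries_eq (e := fun _ _ => 1)
    (g := fun l => m < l) (c := 1) (fun l r => rfl) l
  refine ⟨?_, fun l hl => ?_⟩
  · simpa [totalSeries, totalSource] using h m
  · have := h l
    simp only [hl, if_true, Nat.cast_one, one_mul] at this
    rw [totalSource, if_pos hl, totalSeries, this]
    simp only [totalSeries]
    ring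

theorem descSeries_eq (l : ℕ) :
    descSeries l = 1 + stairSum l + X * descSeries (l + 1) + X ^ (l + 1) * descSeries (l - 1) := by
  have := walkSeries_eq (e := fun _ _ => 1) (g := fun _ => True) (c := 1) (fun l r => rfl) l
  simp only [if_true, Nat.cast_one, one_mul] at this
  rw [descSeries, this]
  simp only [descSeries]
  ring

/-- A walk in `T_m` that starts above level `m` and ends at `12(m+1)(m+2)` consists of
a walk in `T_{m+1}`, the path of `m + 2` edges down to that vertex, and a closed walk. -/
theorem returnSeries_succ {m l : ℕ} (hl : m + 1 ≤ l) :
    returnSeries m l = returnSeries (m + 1) l * (X ^ (m + 2) * returnSeries m m) := by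
  have hR := solves_returnSeries m
  have hR' := solves_returnSeries (m + 1)
  have h0 : Solves (m + 1) (fun _ => 0) (fun _ => 0) := by simp [Solves]
  have h1 := h0.add_mul hR' (X ^ (m + 2) * returnSeries m m)
  simp only [zero_add] at h1
  refine Solves.unique (c := fun l => (if l = m + 1 then 1 else 0) * _) ⟨?_, fun l hl => ?_⟩ h1 hl
  · rw [hR.2 (m + 1) (by omega)]
    simp only [Nat.add_sub_cancel, if_neg (show ¬ m + 1 = m by omega), if_true]
    ring
  · rw [hR.2 l (by omega)]
    simp only [if_neg (show ¬ l = m by omega), if_neg (show ¬ l = m + 1 by omega)]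
    ring

/-- A walk in `T_m` that starts above level `m` either stays above `12(m+1)(m+2)`, possibly stopping
on the path that leads there, or it reaches that vertex. -/
theorem totalSeries_succ {m l : ℕ} (hl : m + 1 ≤ l) :
    totalSeries m l = totalSeries (m + 1) l +
      returnSeries (m + 1) l * (stairSum (m + 1) + X ^ (m + 2) * totalSeries m m) := by
  have hT := solves_totalSeries m
  have h1 := (solves_totalSeries (m + 1)).add_mul (solves_returnSeries (m + 1))
    (stairSum (m + 1) + X ^ (m + 2) * totalSeries m m)
  refine Solves.unique ⟨?_, fun l hl => ?_⟩ h1 hl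
  · rw [hT.2 (m + 1) (by omega)]
    simp only [Nat.add_sub_cancel, totalSource, if_pos (Nat.lt_succ_self m), lt_irrefl, if_true,
      if_false]
    ring
  · rw [hT.2 l (by omega)]
    simp only [totalSource, if_neg (show ¬ l = m + 1 by omega), if_pos hl,
      if_pos (show m < l by omega)]
    ring

/-- A walk that starts at level `l ≥ 1` either stays in `T_1`, or it leaves `T_1` by the path of two
edges from `123` to `12`, on which it may stop. -/
theorem descSeries_of_one_le {l : ℕ} (hl : 1 ≤ l) :
    descSeries l = totalSeries 1 l +
      returnSeries 1 l * (stairSum 1 + X ^ 2 * descSeries 0) := by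
  have h1 := (solves_totalSeries 1).add_mul (solves_returnSeries 1)
    (stairSum 1 + X ^ 2 * descSeries 0)
  refine Solves.unique ⟨?_, fun l hl => ?_⟩ h1 hl
  · rw [descSeries_eq 1]
    simp only [totalSource, lt_irrefl, if_true, if_false]
    ring
  · rw [descSeries_eq l]
    simp only [totalSource, if_neg (show ¬ l = 1 by omega), if_pos hl]
    ring

/-! ### The continued fraction and the series for `tot` -/

theorem H_recurrence {m : ℕ} (hm : 1 ≤ m) : H m = 1 + X ^ (m + 3) * H (m + 1) * H m := by
  rw [H_eq hm, H_eq (by omega : 1 ≤ m + 1)]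
  conv_lhs => rw [(solves_returnSeries m).1, returnSeries_succ le_rfl]
  simp only [if_true]
  ring

theorem H_mul_eq_one {m : ℕ} (hm : 1 ≤ m) : H m * (1 - X ^ (m + 3) * H (m + 1)) = 1 := by
  have := H_recurrence hm
  linear_combination this

theorem convergent_recurrence (N m : ℕ) :
    convergent (N + 1) m = 1 + X ^ (m + 3) * convergent N (m + 1) * convergent (N + 1) m := by
  have h : (1 - X ^ (m + 3) * convergent N (m + 1)) * convergent (N + 1) m = 1 := by
    rw [convergent]
    refine PowerSeries.mul_inv_cancel _ ?_
    simp
  linear_combination h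

theorem coeff_X_pow_mul_congr {k n : ℕ} {A B : ℚ⟦X⟧}
    (h : ∀ i, i + k ≤ n → coeff i A = coeff i B) :
    coeff n (X ^ k * A) = coeff n (X ^ k * B) := by
  rw [coeff_X_pow_mul', coeff_X_pow_mul']
  split_ifs with hk
  · exact h _ (by omega)
  · rfl

theorem coeff_mul_congr {n : ℕ} {A A' B B' : ℚ⟦X⟧} (hA : ∀ i ≤ n, coeff i A = coeff i A')
    (hB : ∀ i ≤ n, coeff i B = coeff i B') : coeff n (A * B) = coeff n (A' * B') := by
  rw [coeff_mul, coeff_mul]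
  refine Finset.sum_congr rfl fun p hp => ?_
  have := Finset.HasAntidiagonal.mem_antidiagonal.1 hp
  rw [hA _ (by omega), hB _ (by omega)]

/-- The `N`-th convergent agrees with `H_m` up to degree `N`. -/
theorem coeff_convergent {N m n : ℕ} (hm : 1 ≤ m) (h : n ≤ N) :
    coeff n (convergent N m) = coeff n (H m) := by
  induction n using Nat.strong_induction_on generalizing N m with
  | _ n ih =>
    cases N with
    | zero =>
      obtain rfl : n = 0 := by omega
      rw [H_recurrence hm, convergent, mul_assoc, map_add, coeff_X_pow_mul', if_neg (by omega),
        add_zero]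
    | succ N =>
      rw [H_recurrence hm, convergent_recurrence, map_add, map_add, mul_assoc, mul_assoc]
      congr 1
      refine coeff_X_pow_mul_congr fun i hi => coeff_mul_congr (fun j hj => ?_) fun j hj => ?_
      · exact ih j (by omega) (by omega) (by omega)
      · exact ih j (by omega) (by omega) (by omega)

theorem formalTendsto_convergent {m : ℕ} (hm : 1 ≤ m) :
    FormalTendsto (fun N => convergent N m) (H m) := fun n =>
  Filter.eventually_atTop.2 ⟨n, fun _ hN => coeff_convergent hm hN⟩

/-- Splitting the walks in `T_m` from `12(m+1)(m+2)` at their last visit to that vertex. The series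
`totalSeries m m + stairSum m * H m` counts the walks that may also end on the path below it. -/
theorem totalSeries_recurrence {m : ℕ} (hm : 1 ≤ m) :
    totalSeries m m =
      H m + X * H m * (totalSeries (m + 1) (m + 1) + stairSum (m + 1) * H (m + 1)) := by
  have h1 := (solves_totalSeries m).1
  rw [totalSeries_succ le_rfl, ← H_eq (by omega : 1 ≤ m + 1)] at h1
  simp only [totalSource, lt_irrefl, if_false] at h1
  have h2 := H_mul_eq_one hm
  linear_combination H m * h1 - totalSeries m m * h2

theorem one_add_stairSum (m : ℕ) : 1 + stairSum m = ∑ j ∈ Finset.range (m + 1), (X : ℚ⟦X⟧) ^ j := by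
  rw [Finset.sum_range_succ', stairSum, pow_zero, add_comm]

theorem tot_eq_sum_add (N : ℕ) :
    tot = (∑ n ∈ Finset.range (N + 1), totTerm n) +
      X ^ (N + 1) * ((∏ i ∈ Finset.Icc 1 (N + 1), H i) *
        (totalSeries (N + 2) (N + 2) + stairSum (N + 2) * H (N + 2))) := by
  induction N with
  | zero =>
    rw [tot_eq, totalSeries_recurrence le_rfl]
    simp [totTerm]
    ring
  | succ N ih =>
    rw [ih, Finset.sum_range_succ _ (N + 1), totTerm, if_neg (by omega),
      totalSeries_recurrence (by omega : 1 ≤ N + 2), ← one_add_stairSum,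
      Finset.prod_Icc_succ_top (by omega : 1 ≤ N + 1 + 1)]
    ring

theorem formalTendsto_totTerm :
    FormalTendsto (fun N => ∑ n ∈ Finset.range N, totTerm n) tot := by
  refine fun n => Filter.eventually_atTop.2 ⟨n + 1, fun N hN => ?_⟩
  obtain ⟨M, rfl⟩ : ∃ M, N = M + 1 := ⟨N - 1, by omega⟩
  rw [tot_eq_sum_add M, map_add, coeff_X_pow_mul', if_neg (by omega), add_zero]

/-! ### The generating function of the `1`-convex permutations -/

/-- The permutations of length `n + 2` are the descendants of `12` and `21`. -/
theorem genFun_one_eq : genFun 1 = 1 + X + 2 * X ^ 2 * descSeries 0 := by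
  ext n
  rw [mul_assoc, two_mul, map_add, map_add, map_add, genFun, coeff_mk]
  match n with
  | 0 => simp [numConvex_zero, coeff_X_pow_mul']
  | 1 => simp [numConvex_one, coeff_X_pow_mul', coeff_one]
  | n + 2 =>
    rw [coeff_X_pow_mul, numConvex_add_two, descSeries, walkSeries, coeff_mk]
    simp [coeff_one, coeff_X, stateCount, two_mul]

theorem descSeries_zero_mul :
    descSeries 0 * (-1 + X + bot * X ^ 3) = -(1 + bot * X ^ 2 + tot * X) := by
  have h0 := descSeries_eq 0
  have h1 := descSeries_of_one_le le_rfl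
  rw [← tot_eq, ← H_eq le_rfl] at h1
  simp only [stairSum, Finset.sum_range_zero, Finset.sum_range_one, zero_add, Nat.zero_sub,
    pow_one] at h0 h1
  rw [bot]
  linear_combination -h0 - X * h1

theorem genFun_one :
    genFun 1 = 1 + X - 2 * X ^ 2 *
      ((1 + bot * X ^ 2 + tot * X) * (-1 + X + bot * X ^ 3)⁻¹) := by
  have hinv : (-1 + X + bot * X ^ 3) * (-1 + X + bot * X ^ 3)⁻¹ = 1 :=
    PowerSeries.mul_inv_cancel _ (by simp)
  rw [genFun_one_eq]
  linear_combination (-2 * X ^ 2 * descSeries 0) * hinv +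
    2 * X ^ 2 * (-1 + X + bot * X ^ 3)⁻¹ * descSeries_zero_mul

end LocallyConvex

theorem mainTheorem5 :
    (∀ m : ℕ, 1 ≤ m →
      LocallyConvex.FormalTendsto (fun N => LocallyConvex.convergent N m) (LocallyConvex.H m)) ∧
    LocallyConvex.FormalTendsto (fun N => LocallyConvex.convergent N 1) LocallyConvex.bot ∧
    LocallyConvex.FormalTendsto
      (fun N => ∑ n ∈ Finset.range N, LocallyConvex.totTerm n) LocallyConvex.tot ∧
    LocallyConvex.genFun 1 =
      1 + PowerSeries.X - 2 * PowerSeries.X ^ 2 *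
        ((1 + LocallyConvex.bot * PowerSeries.X ^ 2 + LocallyConvex.tot * PowerSeries.X) *
          (-1 + PowerSeries.X + LocallyConvex.bot * PowerSeries.X ^ 3)⁻¹) :=
  ⟨fun _ hm => LocallyConvex.formalTendsto_convergent hm,
    LocallyConvex.formalTendsto_convergent le_rfl, LocallyConvex.formalTendsto_totTerm,
    LocallyConvex.genFun_one⟩
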